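/- Let $\lambda>0$, $\varepsilon>0$ and $L>0$. Let $X_1<X_2<\cdots$ be the points of a homogeneous Poisson process of intensity $\lambda$ on $[0,\infty)$, that is, $X_1$ and the differences $X_{i+1}-X_i$ ($i\ge 1$) are independent and exponentially distributed with parameter $\lambda$. The points are regarded as sensors, and two sensors are directly connected if their distance is at most $\varepsilon$; a cluster is a maximal set of sensors that are connected directly or through a chain of directly connected sensors. The $i$-th cluster begins at its first sensor $A_i$ and ends at $E_i$, which is the position of its last sensor plus $\varepsilon$; explicitly, $A_1=X_1$, $$A_i=\inf\{X_j : j\ge 2,\ X_j>A_{i-1},\ X_j-X_{j-1}>\varepsilon\}\quad(i>1),\qquad E_i=\inf\{X_j+\varepsilon : X_j\ge A_i,\ X_{j+1}-X_j>\varepsilon\}.$$ Let $\beta_0(L)=\#\{i\ge 1 : E_i\le L\}$ be the number of complete clusters in $[0,L]$. Then $\beta_0(L)$ is almost surely finite, and for every integer $m\ge 1$ its $m$-th moment is finite and equals $$\mathbb{E}\big[\beta_0(L)^m\big]=\sum_{k=1}^{m} S(m,k)\left(\Big(\frac{L}{\varepsilon}-k\Big)\lambda\varepsilon e^{-\lambda\varepsilon}\right)^{k}\mathbf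 1\{L/\varepsilon>k\},$$ where $S(m,k)$ denotes the Stirling number of the second kind, the number of partitions of a set of $m$ elements into $k$ non-empty blocks. -/

import Mathlib

open MeasureTheory ProbabilityTheory

/-- The gaps of a sequence of positions on the half-line: the distance from the origin to the
first position, then the distances between consecutive positions. (The positions are numbered
from `0`.) -/
def interarrival (x : ℕ → ℝ) : ℕ → ℝ
  | 0 => x 0
  | i + 1 => x (i + 1) - x i

/-- `X 0 < X 1 < ⋯` are the successive points of a homogeneous Poisson process of intensity `lam`
on the half-line: the gaps are independent and exponentially distributed with parameter `lam`. -/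
structure IsPoissonProcess {Ω : Type*} [MeasurableSpace Ω] (μ : Measure Ω) (lam : ℝ)
    (X : ℕ → Ω → ℝ) : Prop where
  measurable : ∀ i, Measurable (X i)
  indep : iIndepFun (fun i ω => interarrival (fun j => X j ω) i) μ
  law : ∀ i, Measure.map (fun ω => interarrival (fun j => X j ω) i) μ = expMeasure lam

/-- The beginning of the `i`-th cluster (clusters are numbered from `0`) of sensors at positions
`x 0 < x 1 < ⋯` with communication range `ε`: the first cluster begins at the first sensor, and
the next one at the first later sensor that is at distance more than `ε` from its predecessor.
The value is `⊤` if there is no such sensor. -/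
noncomputable def clusterStart (ε : ℝ) (x : ℕ → ℝ) : ℕ → EReal
  | 0 => (x 0 : EReal)
  | i + 1 => sInf {a : EReal | ∃ j : ℕ, a = (x (j + 1) : EReal) ∧
      clusterStart ε x i < (x (j + 1) : EReal) ∧ ε < x (j + 1) - x j}

/-- The end of the `i`-th cluster: `x j + ε`, where `x j` is the first sensor, from the beginning
of the cluster on, whose successor is at distance more than `ε`. -/
noncomputable def clusterEnd (ε : ℝ) (x : ℕ → ℝ) (i : ℕ) : EReal :=
  sInf {e : EReal | ∃ j : ℕ, e = ((x j + ε : ℝ) : EReal) ∧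
    clusterStart ε x i ≤ (x j : EReal) ∧ ε < x (j + 1) - x j}

/-- The (indices of the) complete clusters in `[0, L]`: those that have ended by `L`. -/
def completeClusters (ε L : ℝ) (x : ℕ → ℝ) : Set ℕ :=
  {i | clusterEnd ε x i ≤ (L : EReal)}

/-- The number `β₀(L)` of complete clusters in `[0, L]`. -/
noncomputable def numCompleteClusters (ε L : ℝ) (x : ℕ → ℝ) : ℕ :=
  (completeClusters ε L x).ncard

/-! Almost surely positions increase and infinitely many gaps exceed `ε`, so the `i`-th cluster ends
`ε` after the `i`-th sensor followed by such a gap. Hence β₀(L) counts the indices `j` with `X j ≤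
T` and next gap greater than `ε`, where `T = L - ε`.

The binomial coefficient of β₀(L) over `k` counts the `k`-chains of such indices
(`chainCount_eq_choose`). To compute its mean M_k(T), split by the first index of the chain. Its
position has an Erlang density, and these densities sum over the index to `lam` on the positive
half-line. The gap after it exceeds `ε` with probability exp(-lam ε), and then its excess is again
exponential. So M_{k+1}(T) = lam exp(-lam ε) ∫₀^T M_k(T - s - ε) ds (`lintegral_chainCount_succ`),
which gives M_k(T) = (lam exp(-lam ε) (T - (k-1)ε)₊)^k / k! for k ≥ 1 (`lintegral_chainCount`).
Multiplying by k! yields the factorial moments, and Stirling numbers turn these into ordinary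
moments. -/

/-! ### Sequences of gaps and the i.i.d. product law -/

/-- The sequence obtained by putting `x` in front of `d`. -/
def consSeq (x : ℝ) (d : ℕ → ℝ) : ℕ → ℝ
  | 0 => x
  | i + 1 => d i

/-- The position reached after the gaps `d 0, …, d j`. -/
def position (d : ℕ → ℝ) (j : ℕ) : ℝ := ∑ i ∈ Finset.range (j + 1), d i

lemma position_consSeq_zero (x : ℝ) (d : ℕ → ℝ) : position (consSeq x d) 0 = x := by
  simp [position, consSeq]

lemma position_consSeq_succ (x : ℝ) (d : ℕ → ℝ) (j : ℕ) :
    position (consSeq x d) (j + 1) = x + position d j := by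
  rw [position, Finset.sum_range_succ', add_comm]; rfl

lemma position_add (d : ℕ → ℝ) (j i : ℕ) :
    position d (j + 1 + i) = position d j + position (fun n => d (j + 1 + n)) i := by
  simp only [position]
  rw [add_assoc (j + 1), Finset.sum_range_add]

@[fun_prop]
lemma measurable_position (j : ℕ) : Measurable fun d : ℕ → ℝ => position d j := by
  unfold position; fun_prop

lemma measurable_consSeq : Measurable fun p : ℝ × (ℕ → ℝ) => consSeq p.1 p.2 := by
  refine measurable_pi_lambda _ fun i => ?_
  cases i with
  | zero => exact measurable_fst
  | succ i => exact (measurable_pi_apply i).comp measurable_snd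

/-- A sequence of independent variables of law `ν` is a variable of law `ν` followed by an
independent such sequence. -/
lemma map_consSeq_prod (ν : Measure ℝ) [IsProbabilityMeasure ν] :
    (ν.prod (Measure.infinitePi fun _ : ℕ => ν)).map (fun p => consSeq p.1 p.2) =
      Measure.infinitePi fun _ : ℕ => ν := by
  refine Measure.eq_infinitePi _ fun s t ht => ?_
  classical
  obtain ⟨n, hn⟩ := s.exists_nat_subset_range
  -- Padding with `Set.univ` turns the cylinder over `s` into one over an initial segment, from
  -- which coordinate `0` splits off.
  let t' : ℕ → Set ℝ := fun i => if i ∈ s then t i else Set.univ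
  have ht' : ∀ i, MeasurableSet (t' i) := fun i => by
    by_cases h : i ∈ s <;> simp [t', h, ht]
  have hpre : (fun p : ℝ × (ℕ → ℝ) => consSeq p.1 p.2) ⁻¹' (Set.pi s t) =
      t' 0 ×ˢ Set.pi (Finset.range n : Set ℕ) (fun i => t' (i + 1)) := by
    ext ⟨x, d⟩
    simp only [Set.mem_preimage, Set.mem_pi, Set.mem_prod, Finset.mem_coe, Finset.mem_range]
    constructor
    · intro h
      refine ⟨?_, fun i _ => ?_⟩
      · by_cases h0 : 0 ∈ s
        · simpa [t', h0, consSeq] using h 0 h0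
        · simp [t', h0]
      · by_cases h0 : i + 1 ∈ s
        · simpa [t', h0, consSeq] using h _ h0
        · simp [t', h0]
    · rintro ⟨h0, h1⟩ i hi
      cases i with
      | zero => simpa [t', hi, consSeq] using h0
      | succ i =>
        have := h1 i (by have := Finset.mem_range.1 (hn hi); omega)
        simpa [t', hi, consSeq] using this
  rw [Measure.map_apply measurable_consSeq (.pi s.countable_toSet fun _ _ => ht _), hpre,
    Measure.prod_prod, Measure.infinitePi_pi _ fun i _ => ht' _, mul_comm,
    ← Finset.prod_range_succ' (fun i => ν (t' i))]
  have hsub : s ⊆ Finset.range (n + 1) := fun i hi =>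
    Finset.mem_range.2 (by have := Finset.mem_range.1 (hn hi); omega)
  rw [← Finset.prod_subset hsub (f := fun i => ν (t' i)) fun i _ hi => by simp [t', hi]]
  exact Finset.prod_congr rfl fun i hi => by simp [t', hi]

lemma lintegral_infinitePi_consSeq (ν : Measure ℝ) [IsProbabilityMeasure ν]
    {F : (ℕ → ℝ) → ENNReal} (hF : Measurable F) :
    ∫⁻ d, F d ∂(Measure.infinitePi fun _ : ℕ => ν) =
      ∫⁻ x, ∫⁻ d, F (consSeq x d) ∂(Measure.infinitePi fun _ : ℕ => ν) ∂ν := by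
  conv_lhs => rw [← map_consSeq_prod ν]
  rw [lintegral_map hF measurable_consSeq,
    lintegral_prod (fun p => F (consSeq p.1 p.2)) (hF.comp measurable_consSeq).aemeasurable]

/-! ### Exponential and Erlang laws -/

/-- The density of the sum of `j + 1` independent exponential variables. -/
noncomputable def erlangDensity (lam : ℝ) (j : ℕ) : ℝ → ENNReal :=
  (Set.Ioi 0).indicator fun s =>
    ENNReal.ofReal (lam ^ (j + 1) * s ^ j / j.factorial * Real.exp (-(lam * s)))

@[fun_prop]
lemma measurable_erlangDensity (lam : ℝ) (j : ℕ) : Measurable (erlangDensity lam j) :=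
  Measurable.indicator (by fun_prop) measurableSet_Ioi

lemma lintegral_expMeasure (lam : ℝ) {f : ℝ → ENNReal} (hf : Measurable f) :
    ∫⁻ x, f x ∂(expMeasure lam) = ∫⁻ x, erlangDensity lam 0 x * f x := by
  have h : expMeasure lam = volume.withDensity (exponentialPDF lam) := rfl
  have hm : Measurable (exponentialPDF lam) := (measurable_exponentialPDFReal lam).ennreal_ofReal
  rw [h, lintegral_withDensity_eq_lintegral_mul _ hm hf]
  refine lintegral_congr_ae ?_
  -- The two densities can differ only at the origin, where `erlangDensity` vanishes by convention.
  filter_upwards [Measure.ae_ne volume (0 : ℝ)] with x hx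
  rcases lt_or_gt_of_ne hx with h | h
  · simp [erlangDensity, exponentialPDF_of_neg h, h.le]
  · simp [erlangDensity, exponentialPDF_of_nonneg h.le, h]

/-- The exponential series cancels the factor exp(-lam s): the mean density of points is the
constant intensity. -/
lemma tsum_erlangDensity {lam : ℝ} (hlam : 0 < lam) (s : ℝ) :
    ∑' j, erlangDensity lam j s = (Set.Ioi 0).indicator (fun _ => ENNReal.ofReal lam) s := by
  by_cases hs : 0 < s
  · simp only [erlangDensity, Set.indicator_of_mem (Set.mem_Ioi.2 hs)]
    have h : HasSum (fun j : ℕ =>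
        lam ^ (j + 1) * s ^ j / j.factorial * Real.exp (-(lam * s))) lam := by
      have := ((NormedSpace.expSeries_div_hasSum_exp (lam * s)).mul_left lam).mul_right
        (Real.exp (-(lam * s)))
      rw [← Real.exp_eq_exp_ℝ, mul_assoc, ← Real.exp_add, add_neg_cancel, Real.exp_zero,
        mul_one] at this
      have e : (fun j : ℕ => lam ^ (j + 1) * s ^ j / j.factorial * Real.exp (-(lam * s))) =
          fun j : ℕ => lam * ((lam * s) ^ j / j.factorial) * Real.exp (-(lam * s)) :=
        funext fun j => by ring
      rwa [e]
    rw [← ENNReal.ofReal_tsum_of_nonneg (fun j => by positivity) h.summable, h.tsum_eq]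
  · simp [erlangDensity, hs]

lemma setLIntegral_Ioc_ofReal {f : ℝ → ℝ} (hf : Continuous f) {a b : ℝ} (hab : a ≤ b)
    (h0 : ∀ s ∈ Set.Ioc a b, 0 ≤ f s) :
    ∫⁻ s in Set.Ioc a b, ENNReal.ofReal (f s) = ENNReal.ofReal (∫ s in a..b, f s) := by
  rw [intervalIntegral.integral_of_le hab, ofReal_integral_eq_lintegral_ofReal]
  · exact (hf.integrableOn_Icc).mono_set Set.Ioc_subset_Icc_self
  · exact (ae_restrict_iff' measurableSet_Ioc).2 (Filter.Eventually.of_forall h0)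

/-- The supports restrict `s` to (0, u), where the exponentials combine to a constant and only a
power of `s` is integrated. -/
lemma lintegral_erlangDensity_conv {lam : ℝ} (hlam : 0 < lam) (j : ℕ) (u : ℝ) :
    ∫⁻ s, erlangDensity lam 0 (u - s) * erlangDensity lam j s = erlangDensity lam (j + 1) u := by
  have h (s : ℝ) : erlangDensity lam 0 (u - s) * erlangDensity lam j s =
      (Set.Ioo 0 u).indicator (fun s => ENNReal.ofReal
        (lam ^ (j + 2) / j.factorial * Real.exp (-(lam * u)) * s ^ j)) s := by
    by_cases hs : 0 < s
    · by_cases hu : s < u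
      · rw [Set.indicator_of_mem (Set.mem_Ioo.2 ⟨hs, hu⟩), erlangDensity, erlangDensity,
          Set.indicator_of_mem (by simpa using hu), Set.indicator_of_mem (by simpa using hs),
          ← ENNReal.ofReal_mul (by have := sub_pos.2 hu; positivity)]
        congr 1
        have : Real.exp (-(lam * u)) = Real.exp (-(lam * (u - s))) * Real.exp (-(lam * s)) := by
          rw [← Real.exp_add]; congr 1; ring
        rw [this]; simp; ring
      · simp [erlangDensity, hu]
    · simp [erlangDensity, hs]
  simp only [h]
  rw [lintegral_indicator measurableSet_Ioo, setLIntegral_congr Ioo_ae_eq_Ioc]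
  by_cases hu : 0 < u
  · rw [setLIntegral_Ioc_ofReal
      (f := fun s => lam ^ (j + 2) / j.factorial * Real.exp (-(lam * u)) * s ^ j)
      (a := 0) (b := u) (by fun_prop) hu.le (fun s hs => by have := hs.1; positivity), erlangDensity,
      Set.indicator_of_mem (by simpa using hu)]
    congr 1
    rw [intervalIntegral.integral_const_mul, integral_pow, Nat.factorial_succ]
    push_cast
    simp
    field_simp
  · simp [erlangDensity, hu, Set.Ioc_eq_empty]

lemma lintegral_expMeasure_erlangDensity {lam : ℝ} (hlam : 0 < lam) (j : ℕ) {h : ℝ → ENNReal}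
    (hh : Measurable h) :
    ∫⁻ x, (∫⁻ s, erlangDensity lam j s * h (x + s)) ∂(expMeasure lam) =
      ∫⁻ u, erlangDensity lam (j + 1) u * h u := by
  have hm : Measurable fun x => ∫⁻ s, erlangDensity lam j s * h (x + s) :=
    Measurable.lintegral_prod_right' (f := fun p : ℝ × ℝ => erlangDensity lam j p.2 * h (p.1 + p.2))
      (by fun_prop)
  calc ∫⁻ x, (∫⁻ s, erlangDensity lam j s * h (x + s)) ∂(expMeasure lam)
      = ∫⁻ x, ∫⁻ s, erlangDensity lam 0 x * (erlangDensity lam j s * h (x + s)) := by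
        rw [lintegral_expMeasure lam hm]
        congr 1 with x
        rw [lintegral_const_mul _ (by fun_prop)]
    _ = ∫⁻ s, ∫⁻ x, erlangDensity lam 0 x * (erlangDensity lam j s * h (x + s)) :=
        lintegral_lintegral_swap (by unfold Function.uncurry; fun_prop)
    _ = ∫⁻ s, ∫⁻ u, erlangDensity lam 0 (u - s) * (erlangDensity lam j s * h u) := by
        congr 1 with s
        rw [← lintegral_sub_right_eq_self _ s]
        simp
    _ = ∫⁻ u, ∫⁻ s, erlangDensity lam 0 (u - s) * (erlangDensity lam j s * h u) :=
        lintegral_lintegral_swap (by unfold Function.uncurry; fun_prop)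
    _ = ∫⁻ u, erlangDensity lam (j + 1) u * h u := by
        congr 1 with u
        rw [← lintegral_erlangDensity_conv hlam, ← lintegral_mul_const _ (by fun_prop)]
        simp only [mul_assoc]

/-- Memorylessness: translation by `ε` multiplies the density by exp(-lam ε) and carries (0, ∞) onto
(ε, ∞). -/
lemma lintegral_expMeasure_indicator (lam : ℝ) {ε : ℝ} (hε : 0 < ε) {f : ℝ → ENNReal}
    (hf : Measurable f) :
    ∫⁻ x, (if ε < x then f x else 0) ∂(expMeasure lam) =
      ENNReal.ofReal (Real.exp (-(lam * ε))) * ∫⁻ x, f (x + ε) ∂(expMeasure lam) := by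
  rw [lintegral_expMeasure lam (Measurable.ite measurableSet_Ioi hf measurable_const),
    lintegral_expMeasure lam (by fun_prop), ← lintegral_const_mul _ (by fun_prop),
    ← lintegral_add_right_eq_self _ ε]
  congr 1 with x
  by_cases hx : 0 < x
  · have hx' : 0 < x + ε := by positivity
    rw [if_pos (by linarith), ← mul_assoc, erlangDensity, Set.indicator_of_mem (by simpa using hx'),
      Set.indicator_of_mem (by simpa using hx), ← ENNReal.ofReal_mul (by positivity)]
    congr 2
    have : Real.exp (-(lam * (x + ε))) = Real.exp (-(lam * x)) * Real.exp (-(lam * ε)) := by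
      rw [← Real.exp_add]; congr 1; ring
    rw [this]; ring
  · rw [if_neg (by linarith)]
    simp [erlangDensity, hx]

/-! ### Binomial coefficients and Stirling numbers -/

/-- Subsets of size `k + 1` are classified by their least element, matching the recursion of
`chainCount`. -/
lemma Finset.choose_card_succ_eq_sum (s : Finset ℕ) (k : ℕ) :
    s.card.choose (k + 1) = ∑ a ∈ s, (s.filter (a < ·)).card.choose k := by
  induction s using Finset.induction_on_min with
  | empty => simp
  | insert a s ha ih =>
    have hn : a ∉ s := fun h => lt_irrefl _ (ha a h)
    rw [Finset.card_insert_of_notMem hn, Finset.sum_insert hn, Nat.choose_succ_succ, ih]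
    congr 1
    · rw [Finset.filter_insert, if_neg (lt_irrefl _), Finset.filter_true_of_mem ha]
    · refine Finset.sum_congr rfl fun b hb => ?_
      rw [Finset.filter_insert, if_neg (ha b hb).not_gt]

/-- Multiplying the falling factorial of order `k` by `n` gives the one of order `k + 1` plus `k`
times itself, which mirrors the Stirling recurrence. -/
lemma Nat.pow_eq_sum_stirlingSecond_mul_descFactorial (n m : ℕ) :
    n ^ m = ∑ k ∈ Finset.range (m + 1), Nat.stirlingSecond m k * n.descFactorial k := by
  induction m with
  | zero => simp
  | succ m ih =>
    have h (k : ℕ) : n * n.descFactorial k = n.descFactorial (k + 1) + k * n.descFactorial k := by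
      rw [Nat.descFactorial_succ, ← add_mul]
      rcases le_or_gt k n with h | h
      · rw [Nat.sub_add_cancel h]
      · simp [Nat.descFactorial_of_lt h]
    have h2 : ∑ k ∈ Finset.range (m + 1), (k + 1) * Nat.stirlingSecond m (k + 1) *
        n.descFactorial (k + 1) =
        ∑ k ∈ Finset.range (m + 1), k * Nat.stirlingSecond m k * n.descFactorial k := by
      have e := Finset.sum_range_succ'
        (fun k => k * Nat.stirlingSecond m k * n.descFactorial k) (m + 1)
      rw [Finset.sum_range_succ, Nat.stirlingSecond_eq_zero_of_lt (Nat.lt_succ_self m)] at e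
      simpa using e.symm
    rw [Finset.sum_range_succ', Nat.stirlingSecond_succ_zero, zero_mul, add_zero, pow_succ, ih,
      Finset.sum_mul]
    have h3 (k : ℕ) : Nat.stirlingSecond (m + 1) (k + 1) * n.descFactorial (k + 1) =
        (k + 1) * Nat.stirlingSecond m (k + 1) * n.descFactorial (k + 1) +
          Nat.stirlingSecond m k * n.descFactorial (k + 1) := by
      rw [Nat.stirlingSecond_succ_succ, add_mul]
    rw [Finset.sum_congr rfl fun k _ => h3 k, Finset.sum_add_distrib, h2, ← Finset.sum_add_distrib]
    refine Finset.sum_congr rfl fun k _ => ?_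
    rw [mul_assoc, mul_comm _ n, h]
    ring

/-! ### Clusters and their last sensors -/

section Clusters

variable {ε : ℝ} {x : ℕ → ℝ}

/-- The `i`-th cluster ends at the `i`-th sensor whose successor is out of range. -/
lemma clusterEnd_of_clusterStart (hx : StrictMono x) (p : ℕ → Prop)
    (hp : ∀ j, p j ↔ ε < x (j + 1) - x j) (hinf : (Set.ofPred p).Infinite) {i n : ℕ}
    (hs : clusterStart ε x i = (x n : EReal)) (hn : n ≤ Nat.nth p i)
    (hmin : ∀ j, p j → n ≤ j → Nat.nth p i ≤ j) :
    clusterEnd ε x i = ((x (Nat.nth p i) + ε : ℝ) : EReal) := by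
  refine IsLeast.csInf_eq ⟨⟨_, rfl, ?_, (hp _).1 (Nat.nth_mem_of_infinite hinf i)⟩, ?_⟩
  · rw [hs]; exact_mod_cast hx.monotone hn
  · rintro _ ⟨j, rfl, h1, h2⟩
    rw [hs] at h1
    have h1' : n ≤ j := hx.le_iff_le.1 (by exact_mod_cast h1)
    have := hx.monotone (hmin j ((hp j).2 h2) h1')
    exact_mod_cast add_le_add_left this ε

lemma clusterStart_eq (hx : StrictMono x) (p : ℕ → Prop)
    (hp : ∀ j, p j ↔ ε < x (j + 1) - x j) (hinf : (Set.ofPred p).Infinite) (i : ℕ) :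
    clusterStart ε x (i + 1) = (x (Nat.nth p i + 1) : EReal) := by
  -- The hypotheses say that the cluster starts at sensor `n` and that its first large gap is the
  -- `i`-th large gap overall; this is what the induction propagates.
  have key (i n : ℕ) (hs : clusterStart ε x i = (x n : EReal)) (hn : n ≤ Nat.nth p i)
      (hmin : ∀ j, p j → n ≤ j → Nat.nth p i ≤ j) :
      clusterStart ε x (i + 1) = (x (Nat.nth p i + 1) : EReal) := by
    refine IsLeast.csInf_eq ⟨⟨_, rfl, ?_, (hp _).1 (Nat.nth_mem_of_infinite hinf i)⟩, ?_⟩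
    · rw [hs]; exact_mod_cast hx (Nat.lt_succ_of_le hn)
    · rintro _ ⟨j, rfl, h1, h2⟩
      rw [hs] at h1
      have h1' : n < j + 1 := hx.lt_iff_lt.1 (by exact_mod_cast h1)
      have := hmin j ((hp j).2 h2) (Nat.lt_succ_iff.1 h1')
      exact_mod_cast hx.monotone (Nat.succ_le_succ this)
  induction i with
  | zero =>
    refine key 0 0 rfl (Nat.zero_le _) fun j hj _ => ?_
    obtain ⟨i, rfl⟩ := (Nat.range_nth_of_infinite hinf).ge hj
    exact (Nat.nth_strictMono hinf).monotone (Nat.zero_le i)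
  | succ i ih =>
    refine key _ _ ih (Nat.succ_le_of_lt (Nat.nth_strictMono hinf (Nat.lt_succ_self i)))
      fun j hj hij => ?_
    obtain ⟨k, rfl⟩ := (Nat.range_nth_of_infinite hinf).ge hj
    exact (Nat.nth_strictMono hinf).monotone ((Nat.nth_strictMono hinf).lt_iff_lt.1 hij)

lemma clusterEnd_eq (hx : StrictMono x) (p : ℕ → Prop)
    (hp : ∀ j, p j ↔ ε < x (j + 1) - x j) (hinf : (Set.ofPred p).Infinite) (i : ℕ) :
    clusterEnd ε x i = ((x (Nat.nth p i) + ε : ℝ) : EReal) := by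
  cases i with
  | zero =>
    refine clusterEnd_of_clusterStart hx p hp hinf (n := 0) rfl (Nat.zero_le _) fun j hj _ => ?_
    obtain ⟨i, rfl⟩ := (Nat.range_nth_of_infinite hinf).ge hj
    exact (Nat.nth_strictMono hinf).monotone (Nat.zero_le i)
  | succ i =>
    refine clusterEnd_of_clusterStart hx p hp hinf (clusterStart_eq hx p hp hinf i)
      (Nat.succ_le_of_lt (Nat.nth_strictMono hinf (Nat.lt_succ_self i))) fun j hj hij => ?_
    obtain ⟨k, rfl⟩ := (Nat.range_nth_of_infinite hinf).ge hj
    exact (Nat.nth_strictMono hinf).monotone ((Nat.nth_strictMono hinf).lt_iff_lt.1 hij)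

/-- Complete clusters correspond to their last sensors. -/
lemma image_nth_completeClusters (hx : StrictMono x)
    (hinf : {j | ε < x (j + 1) - x j}.Infinite) (L : ℝ) :
    Nat.nth (fun j => ε < x (j + 1) - x j) '' completeClusters ε L x =
      {j | x j ≤ L - ε ∧ ε < x (j + 1) - x j} := by
  ext j
  simp only [completeClusters, Set.mem_image, Set.mem_ofPred_eq,
    clusterEnd_eq hx _ (fun _ => Iff.rfl) hinf, EReal.coe_le_coe_iff, ← le_sub_iff_add_le]
  constructor
  · rintro ⟨i, hi, rfl⟩
    exact ⟨hi, Nat.nth_mem_of_infinite hinf i⟩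
  · rintro ⟨h1, h2⟩
    obtain ⟨i, rfl⟩ := (Nat.range_nth_of_infinite hinf).ge h2
    exact ⟨i, h1, rfl⟩

end Clusters

/-! ### Counting chains of large gaps -/

/-- The number of `k`-chains `j₁ < ⋯ < j_k` of indices whose position is at most `T` and whose
next gap is greater than `ε`, counted by the first element of the chain. -/
noncomputable def chainCount (ε : ℝ) : ℕ → (ℕ → ℝ) → ℝ → ENNReal
  | 0, _, _ => 1
  | k + 1, d, T => ∑' j, if position d j ≤ T ∧ ε < d (j + 1) then
      chainCount ε k (fun i => d (j + 1 + i)) (T - position d j) else 0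

/-- Restarting after index `j` reindexes the admissible indices beyond `j` by `i ↦ j + 1 + i`, so
the recursion selects a subset by its minimum. -/
lemma chainCount_eq_choose (ε : ℝ) (k : ℕ) (d : ℕ → ℝ) (T : ℝ) (s : Finset ℕ)
    (hs : ∀ j, j ∈ s ↔ position d j ≤ T ∧ ε < d (j + 1)) :
    chainCount ε k d T = (s.card.choose k : ℕ) := by
  induction k generalizing d T s with
  | zero => simp [chainCount]
  | succ k ih =>
    rw [chainCount, tsum_eq_sum (s := s) fun j hj => if_neg ((hs j).not.1 hj),
      Finset.choose_card_succ_eq_sum, Nat.cast_sum]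
    refine Finset.sum_congr rfl fun j hj => ?_
    have hinj : Function.Injective fun i => j + 1 + i := add_right_injective _
    rw [if_pos ((hs j).1 hj), ih _ _ (s.preimage (fun i => j + 1 + i) hinj.injOn) fun i => by
      rw [Finset.mem_preimage, hs, position_add, le_sub_iff_add_le']; rfl]
    congr 2
    rw [← Finset.card_image_of_injective _ hinj]
    congr 1
    ext a
    simp only [Finset.mem_image, Finset.mem_preimage, Finset.mem_filter]
    constructor
    · rintro ⟨i, hi, rfl⟩
      exact ⟨hi, by omega⟩
    · rintro ⟨ha, hja⟩
      obtain ⟨i, rfl⟩ := Nat.exists_eq_add_of_le (Nat.succ_le_of_lt hja)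
      exact ⟨i, ha, rfl⟩

lemma finite_of_chainCount_one_ne_top {ε : ℝ} {d : ℕ → ℝ} {T : ℝ} (h : chainCount ε 1 d T ≠ ⊤) :
    {j | position d j ≤ T ∧ ε < d (j + 1)}.Finite := by
  refine (ENNReal.finite_const_le_of_tsum_ne_top h one_ne_zero).subset fun j hj => ?_
  simp only [Set.mem_ofPred_eq] at hj ⊢
  simp [hj, chainCount]

@[fun_prop]
lemma measurable_chainCount (ε : ℝ) (k : ℕ) :
    Measurable fun p : (ℕ → ℝ) × ℝ => chainCount ε k p.1 p.2 := by
  induction k with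
  | zero => exact measurable_const
  | succ k ih =>
    simp only [chainCount]
    refine Measurable.tsum fun j => Measurable.ite ?_ ?_ measurable_const
    · have h1 : MeasurableSet {p : (ℕ → ℝ) × ℝ | position p.1 j ≤ p.2} :=
        measurableSet_le (by fun_prop) (by fun_prop)
      have h2 : MeasurableSet {p : (ℕ → ℝ) × ℝ | ε < p.1 (j + 1)} :=
        measurableSet_lt (by fun_prop) (by fun_prop)
      exact h1.inter h2
    · exact ih.comp (f := fun p : (ℕ → ℝ) × ℝ =>
        ((fun i => p.1 (j + 1 + i)), p.2 - position p.1 j)) (by fun_prop)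

/-- Lengthening gap `0` shifts all positions equally, and no condition on large gaps ever tests gap
`0`. -/
lemma chainCount_consSeq_add (ε : ℝ) (k : ℕ) (x : ℝ) (d : ℕ → ℝ) (t : ℝ) :
    chainCount ε k (consSeq (x + ε) d) t = chainCount ε k (consSeq x d) (t - ε) := by
  cases k with
  | zero => rfl
  | succ k =>
    have hpos (j : ℕ) : position (consSeq (x + ε) d) j = position (consSeq x d) j + ε := by
      cases j with
      | zero => simp [position_consSeq_zero]
      | succ j => simp only [position_consSeq_succ]; ring
    have htail (j i : ℕ) : consSeq (x + ε) d (j + 1 + i) = consSeq x d (j + 1 + i) := by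
      rw [add_right_comm]; rfl
    simp only [chainCount, hpos, htail, ← le_sub_iff_add_le, sub_add_eq_sub_sub_swap]
    rfl

/-! ### Expected number of chains -/

section Expectation

variable {lam ε : ℝ}

/-- Memorylessness: conditionally on being greater than `ε`, the first gap is distributed as
`ε` plus a gap. -/
lemma lintegral_chainCount_first_gap (hlam : 0 < lam) (hε : 0 < ε) (k : ℕ) (t : ℝ) :
    ∫⁻ d, (if ε < d 0 then chainCount ε k d t else 0)
        ∂(Measure.infinitePi fun _ : ℕ => expMeasure lam) =
      ENNReal.ofReal (Real.exp (-(lam * ε))) *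
        ∫⁻ d, chainCount ε k d (t - ε) ∂(Measure.infinitePi fun _ : ℕ => expMeasure lam) := by
  have := isProbabilityMeasure_expMeasure hlam
  have hcons (t : ℝ) : Measurable fun p : ℝ × (ℕ → ℝ) => chainCount ε k (consSeq p.1 p.2) t :=
    (measurable_chainCount ε k).comp (measurable_consSeq.prodMk measurable_const)
  have hmeas : Measurable fun d : ℕ → ℝ => chainCount ε k d t := by fun_prop
  rw [lintegral_infinitePi_consSeq _ (hmeas.ite
      (measurableSet_lt measurable_const (measurable_pi_apply 0)) measurable_const),
    lintegral_infinitePi_consSeq _ (by fun_prop)]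
  have h (x : ℝ) : ∫⁻ d, (if ε < consSeq x d 0 then chainCount ε k (consSeq x d) t else 0)
      ∂(Measure.infinitePi fun _ : ℕ => expMeasure lam) =
      if ε < x then ∫⁻ d, chainCount ε k (consSeq x d) t
        ∂(Measure.infinitePi fun _ : ℕ => expMeasure lam) else 0 := by
    by_cases hx : ε < x <;> simp [consSeq, hx]
  simp only [h]
  rw [lintegral_expMeasure_indicator lam hε (hcons t).lintegral_prod_right']
  simp only [chainCount_consSeq_add]

/-- The position and the later gaps are independent, and the position has an Erlang density. -/
lemma lintegral_position_tail (hlam : 0 < lam) (j : ℕ) {H : ℝ → (ℕ → ℝ) → ENNReal}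
    (hH : Measurable fun p : ℝ × (ℕ → ℝ) => H p.1 p.2) :
    ∫⁻ d, H (position d j) (fun i => d (j + 1 + i))
        ∂(Measure.infinitePi fun _ : ℕ => expMeasure lam) =
      ∫⁻ s, erlangDensity lam j s *
        ∫⁻ d, H s d ∂(Measure.infinitePi fun _ : ℕ => expMeasure lam) := by
  have := isProbabilityMeasure_expMeasure hlam
  have hcomp (j : ℕ) {H : ℝ → (ℕ → ℝ) → ENNReal} (hH : Measurable fun p : ℝ × (ℕ → ℝ) => H p.1 p.2) :
      Measurable fun d : ℕ → ℝ => H (position d j) (fun i => d (j + 1 + i)) :=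
    hH.comp (f := fun d : ℕ → ℝ => (position d j, fun i => d (j + 1 + i))) (by fun_prop)
  induction j generalizing H with
  | zero =>
    rw [lintegral_infinitePi_consSeq _ (hcomp 0 hH), ← lintegral_expMeasure _
      hH.lintegral_prod_right']
    simp only [position_consSeq_zero]
    have htail (x : ℝ) (d : ℕ → ℝ) : (fun i => consSeq x d (0 + 1 + i)) = d := by
      funext i
      rw [zero_add, add_comm]; rfl
    simp only [htail]
  | succ j ih =>
    rw [lintegral_infinitePi_consSeq _ (hcomp (j + 1) hH),
      ← lintegral_expMeasure_erlangDensity hlam j hH.lintegral_prod_right']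
    congr 1 with x
    have hx : Measurable fun p : ℝ × (ℕ → ℝ) => H (x + p.1) p.2 :=
      hH.comp (f := fun p : ℝ × (ℕ → ℝ) => (x + p.1, p.2)) (by fun_prop)
    rw [← ih hx]
    have htail (d : ℕ → ℝ) :
        (fun i => consSeq x d (j + 1 + 1 + i)) = fun i => d (j + 1 + i) := by
      funext i
      rw [add_right_comm]; rfl
    simp only [position_consSeq_succ, htail]

/-- The renewal equation for the means: independence of position and tail, the sum of the Erlang
densities, and memorylessness of the gap after the first index. -/
lemma lintegral_chainCount_succ (hlam : 0 < lam) (hε : 0 < ε) (k : ℕ) (T : ℝ) :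
    ∫⁻ d, chainCount ε (k + 1) d T ∂(Measure.infinitePi fun _ : ℕ => expMeasure lam) =
      ENNReal.ofReal (lam * Real.exp (-(lam * ε))) * ∫⁻ s in Set.Ioc 0 T,
        ∫⁻ d, chainCount ε k d (T - s - ε) ∂(Measure.infinitePi fun _ : ℕ => expMeasure lam) := by
  have := isProbabilityMeasure_expMeasure hlam
  set P := Measure.infinitePi fun _ : ℕ => expMeasure lam with hP
  let H : ℝ → (ℕ → ℝ) → ENNReal := fun s d =>
    if s ≤ T ∧ ε < d 0 then chainCount ε k d (T - s) else 0
  have hH : Measurable fun p : ℝ × (ℕ → ℝ) => H p.1 p.2 := by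
    refine Measurable.ite ?_ ?_ measurable_const
    · have h1 : MeasurableSet {p : ℝ × (ℕ → ℝ) | p.1 ≤ T} :=
        measurableSet_le (by fun_prop) (by fun_prop)
      have h2 : MeasurableSet {p : ℝ × (ℕ → ℝ) | ε < p.2 0} :=
        measurableSet_lt (by fun_prop) (by fun_prop)
      exact h1.inter h2
    · exact (measurable_chainCount ε k).comp (f := fun p : ℝ × (ℕ → ℝ) => (p.2, T - p.1))
        (by fun_prop)
  have hHint (s : ℝ) : ∫⁻ d, H s d ∂P = if s ≤ T then
      ENNReal.ofReal (Real.exp (-(lam * ε))) * ∫⁻ d, chainCount ε k d (T - s - ε) ∂P else 0 := by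
    by_cases hs : s ≤ T
    · simp only [H, hs, true_and, if_true]
      exact lintegral_chainCount_first_gap hlam hε k (T - s)
    · simp [H, hs]
  have hM : Measurable fun s => ∫⁻ d, chainCount ε k d (T - s - ε) ∂P :=
    Measurable.lintegral_prod_right' (f := fun p : ℝ × (ℕ → ℝ) =>
      chainCount ε k p.2 (T - p.1 - ε)) ((measurable_chainCount ε k).comp
        (f := fun p : ℝ × (ℕ → ℝ) => (p.2, T - p.1 - ε)) (by fun_prop))
  calc ∫⁻ d, chainCount ε (k + 1) d T ∂P
      = ∑' j, ∫⁻ d, H (position d j) (fun i => d (j + 1 + i)) ∂P := by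
        simp only [chainCount]
        exact lintegral_tsum fun j => (hH.comp
          (f := fun d : ℕ → ℝ => (position d j, fun i => d (j + 1 + i)))
          (by fun_prop)).aemeasurable
    _ = ∑' j, ∫⁻ s, erlangDensity lam j s * ∫⁻ d, H s d ∂P := by
        simp only [hP, lintegral_position_tail hlam _ hH]
    _ = ∫⁻ s, (Set.Ioi 0).indicator (fun _ => ENNReal.ofReal lam) s * ∫⁻ d, H s d ∂P := by
        have hHm : Measurable fun s => ∫⁻ d, H s d ∂P := hH.lintegral_prod_right'
        rw [← lintegral_tsum fun j => by fun_prop]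
        simp only [ENNReal.tsum_mul_right, tsum_erlangDensity hlam]
    _ = ∫⁻ s, (Set.Ioc 0 T).indicator (fun s => ENNReal.ofReal (lam * Real.exp (-(lam * ε))) *
          ∫⁻ d, chainCount ε k d (T - s - ε) ∂P) s := by
        congr 1 with s
        rw [hHint]
        by_cases h0 : 0 < s <;> by_cases hT : s ≤ T <;>
          simp [h0, hT, ENNReal.ofReal_mul hlam.le, mul_assoc]
    _ = _ := by
        rw [lintegral_indicator measurableSet_Ioc, lintegral_const_mul _ hM]

/-- For `k = 0` the convention 0 ^ 0 = 1 would keep mass on (T - a, T]; hence `k ≠ 0`, and the first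
moment is computed separately. -/
lemma setLIntegral_ofReal_max_pow {T a : ℝ} (ha : 0 ≤ a) (k : ℕ) (hk : k ≠ 0) :
    ∫⁻ s in Set.Ioc 0 T, ENNReal.ofReal (max (T - a - s) 0 ^ k) =
      ENNReal.ofReal (max (T - a) 0 ^ (k + 1) / (k + 1)) := by
  have h : ∫⁻ s in Set.Ioc 0 T, ENNReal.ofReal (max (T - a - s) 0 ^ k) =
      ∫⁻ s in Set.Ioc 0 (T - a), ENNReal.ofReal ((T - a - s) ^ k) := by
    rw [← lintegral_indicator measurableSet_Ioc, ← lintegral_indicator measurableSet_Ioc]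
    congr 1 with s
    by_cases h0 : 0 < s
    · by_cases hs : s ≤ T - a
      · have hT : s ≤ T := by linarith
        simp [h0, hs, hT]
      · have : max (T - a - s) 0 = 0 := max_eq_right (by linarith)
        simp only [Set.indicator_apply, this, ne_eq, hk, not_false_eq_true, zero_pow,
          ENNReal.ofReal_zero, ite_self, Set.mem_Ioc, hs, and_false, if_false]
    · simp [h0]
  rw [h]
  by_cases hTa : 0 ≤ T - a
  · rw [setLIntegral_Ioc_ofReal (f := fun s => (T - a - s) ^ k) (by fun_prop) hTa
      fun s hs => pow_nonneg (sub_nonneg.2 hs.2) _,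
      intervalIntegral.integral_comp_sub_left (fun s => s ^ k), integral_pow, max_eq_left hTa]
    simp
  · rw [max_eq_right (by linarith), Set.Ioc_eq_empty (by linarith)]
    simp

lemma lintegral_chainCount (hlam : 0 < lam) (hε : 0 < ε) (k : ℕ) (T : ℝ) :
    ∫⁻ d, chainCount ε (k + 1) d T ∂(Measure.infinitePi fun _ : ℕ => expMeasure lam) =
      ENNReal.ofReal ((lam * Real.exp (-(lam * ε))) ^ (k + 1) *
        (max (T - k * ε) 0 ^ (k + 1) / (k + 1).factorial)) := by
  have := isProbabilityMeasure_expMeasure hlam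
  induction k generalizing T with
  | zero =>
    rw [lintegral_chainCount_succ hlam hε]
    simp only [chainCount, lintegral_const, measure_univ, mul_one]
    rw [one_mul, Measure.restrict_apply_univ, Real.volume_Ioc,
      ← ENNReal.ofReal_mul (by positivity)]
    rcases le_total 0 T with hT | hT
    · simp [hT]
    · simpa [hT] using mul_nonpos_of_nonneg_of_nonpos
        (mul_nonneg hlam.le (Real.exp_nonneg (-(lam * ε)))) hT
  | succ k ih =>
    rw [lintegral_chainCount_succ hlam hε]
    have h (s : ℝ) : ∫⁻ d, chainCount ε (k + 1) d (T - s - ε)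
        ∂(Measure.infinitePi fun _ : ℕ => expMeasure lam) =
        ENNReal.ofReal ((lam * Real.exp (-(lam * ε))) ^ (k + 1) / (k + 1).factorial) *
          ENNReal.ofReal (max (T - (k + 1 : ℕ) * ε - s) 0 ^ (k + 1)) := by
      rw [ih, ← ENNReal.ofReal_mul (by positivity)]
      have : T - s - ε - k * ε = T - (k + 1 : ℕ) * ε - s := by push_cast; ring
      rw [this]
      congr 1
      ring
    simp only [h]
    rw [lintegral_const_mul _ (by fun_prop),
      setLIntegral_ofReal_max_pow (by positivity) _ (Nat.succ_ne_zero k),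
      ← ENNReal.ofReal_mul (by positivity), ← ENNReal.ofReal_mul (by positivity)]
    congr 1
    rw [Nat.factorial_succ (k + 1)]
    push_cast
    field_simp
    simp only [Nat.succ_eq_add_one]
    ring

end Expectation

/-! ### Transfer to the Poisson process -/

lemma position_interarrival (x : ℕ → ℝ) (j : ℕ) : position (interarrival x) j = x j := by
  rw [position, Finset.sum_range_succ']
  simp only [interarrival]
  rw [Finset.sum_range_sub]
  ring

namespace IsPoissonProcess

variable {Ω : Type*} [MeasurableSpace Ω] {μ : Measure Ω} {lam ε L : ℝ} {X : ℕ → Ω → ℝ}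

lemma measurable_interarrival (hX : IsPoissonProcess μ lam X) (i : ℕ) :
    Measurable fun ω => interarrival (fun j => X j ω) i := by
  cases i with
  | zero => exact hX.measurable 0
  | succ i => exact (hX.measurable (i + 1)).sub (hX.measurable i)

lemma map_interarrival [IsProbabilityMeasure μ] (hX : IsPoissonProcess μ lam X) :
    μ.map (fun ω => interarrival fun j => X j ω) =
      Measure.infinitePi fun _ : ℕ => expMeasure lam := by
  have := hX.indep.map_fun_eq_infinitePi_map hX.measurable_interarrival
  simpa only [hX.law] using this

lemma lintegral_chainCount_interarrival [IsProbabilityMeasure μ] (hlam : 0 < lam) (hε : 0 < ε)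
    (hX : IsPoissonProcess μ lam X) (k : ℕ) (T : ℝ) :
    ∫⁻ ω, chainCount ε (k + 1) (interarrival fun j => X j ω) T ∂μ =
      ENNReal.ofReal ((lam * Real.exp (-(lam * ε))) ^ (k + 1) *
        (max (T - k * ε) 0 ^ (k + 1) / (k + 1).factorial)) := by
  rw [← lintegral_chainCount hlam hε, ← hX.map_interarrival,
    lintegral_map (by fun_prop) (measurable_pi_lambda _ hX.measurable_interarrival)]

lemma ae_strictMono [IsProbabilityMeasure μ] (hX : IsPoissonProcess μ lam X) :
    ∀ᵐ ω ∂μ, StrictMono fun j => X j ω := by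
  have h (i : ℕ) : ∀ᵐ ω ∂μ, 0 < interarrival (fun j => X j ω) i := by
    have h0 : ∀ᵐ x ∂(expMeasure lam), (0 : ℝ) < x := by
      have hm : MeasurableSet {x : ℝ | ¬0 < x} := measurableSet_Ioi.compl
      rw [ae_iff, ← lintegral_indicator_one hm, lintegral_expMeasure _ (measurable_one.indicator hm)]
      refine (lintegral_congr fun x => ?_).trans lintegral_zero
      by_cases hx : 0 < x <;> simp [erlangDensity, hx]
    rw [← hX.law i] at h0
    exact ae_of_ae_map (hX.measurable_interarrival i).aemeasurable h0
  filter_upwards [ae_all_iff.2 h] with ω hω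
  exact strictMono_nat_of_lt_succ fun j => sub_pos.1 (hω (j + 1))

/-- Second Borel–Cantelli lemma: the events are independent with the same positive probability. -/
lemma ae_infinite_gaps [IsProbabilityMeasure μ] (hlam : 0 < lam) (hε : 0 < ε)
    (hX : IsPoissonProcess μ lam X) :
    ∀ᵐ ω ∂μ, {j | ε < X (j + 1) ω - X j ω}.Infinite := by
  let s : ℕ → Set Ω := fun j => {ω | ε < X (j + 1) ω - X j ω}
  have hs (j : ℕ) : s j =
      (fun ω => interarrival (fun j => X j ω) (j + 1)) ⁻¹' Set.Ioi ε := rfl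
  have hsm (j : ℕ) : MeasurableSet (s j) := hX.measurable_interarrival (j + 1) measurableSet_Ioi
  have hind : iIndepSet s μ := by
    rw [iIndepSet_iff_meas_biInter hsm]
    intro t
    exact (hX.indep.precomp (add_left_injective 1)).measure_inter_preimage_eq_mul t
      fun _ _ => measurableSet_Ioi
  have hprob (j : ℕ) : μ (s j) = ENNReal.ofReal (Real.exp (-(lam * ε))) := by
    have := isProbabilityMeasure_expMeasure hlam
    rw [hs, ← Measure.map_apply (hX.measurable_interarrival _) measurableSet_Ioi, hX.law]
    have h := lintegral_expMeasure_indicator lam hε (f := fun _ => 1) measurable_const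
    rw [← lintegral_indicator_one measurableSet_Ioi]
    simpa [Set.indicator_apply] using h
  have hsum : ∑' j, μ (s j) = ⊤ := by
    simp only [hprob]
    exact ENNReal.tsum_const_eq_top_of_ne_zero (by simp [Real.exp_pos])
  have h1 := measure_limsup_eq_one hsm hind hsum
  have h2 : ∀ᵐ ω ∂μ, ω ∈ Filter.limsup s Filter.atTop :=
    (prob_compl_eq_zero_iff (MeasurableSet.measurableSet_limsup hsm)).2 h1
  filter_upwards [h2] with ω hω
  rw [← Nat.frequently_atTop_iff_infinite]
  rwa [Filter.mem_limsup_iff_frequently_mem] at hω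

/-- Almost surely, `chainCount` counts the sets of `k` complete clusters. -/
lemma ae_chainCount_eq [IsProbabilityMeasure μ] (hlam : 0 < lam) (hε : 0 < ε)
    (hX : IsPoissonProcess μ lam X) (L : ℝ) :
    ∀ᵐ ω ∂μ, (completeClusters ε L (fun j => X j ω)).Finite ∧
      ∀ k, chainCount ε k (interarrival fun j => X j ω) (L - ε) =
        ((numCompleteClusters ε L (fun j => X j ω)).choose k : ℕ) := by
  -- A finite mean number of one-element chains forces almost sure finiteness of the set of cluster
  -- ends.
  have hfin : ∀ᵐ ω ∂μ, chainCount ε 1 (interarrival fun j => X j ω) (L - ε) < ⊤ := by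
    refine ae_lt_top ?_ ?_
    · exact (measurable_chainCount ε 1).comp
        ((measurable_pi_lambda _ hX.measurable_interarrival).prodMk measurable_const)
    · rw [hX.lintegral_chainCount_interarrival hlam hε 0]
      exact ENNReal.ofReal_ne_top
  filter_upwards [hX.ae_strictMono, hX.ae_infinite_gaps hlam hε, hfin] with ω hmono hinf hω
  have himg := image_nth_completeClusters hmono hinf L
  have hF := finite_of_chainCount_one_ne_top hω.ne
  simp only [position_interarrival] at hF
  have hinj := Nat.nth_injective hinf
  refine ⟨Set.Finite.of_finite_image (himg ▸ hF) hinj.injOn, fun k => ?_⟩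
  rw [chainCount_eq_choose ε k _ _ hF.toFinset fun j => by
      rw [Set.Finite.mem_toFinset, position_interarrival]; rfl,
    ← Set.ncard_eq_toFinset_card _ hF, numCompleteClusters,
    ← Set.ncard_image_of_injective (completeClusters ε L fun j => X j ω) hinj, himg]
  rfl

/-- The factorial moments of the number of complete clusters. -/
lemma integral_descFactorial_numCompleteClusters [IsProbabilityMeasure μ] (hlam : 0 < lam) (hε : 0 < ε)
    (hX : IsPoissonProcess μ lam X) (L : ℝ) (k : ℕ) :
    Integrable (fun ω => ((numCompleteClusters ε L (fun j => X j ω)).descFactorial (k + 1) : ℝ)) μ ∧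
    ∫ ω, ((numCompleteClusters ε L (fun j => X j ω)).descFactorial (k + 1) : ℝ) ∂μ =
      (lam * Real.exp (-(lam * ε)) * max (L - (k + 1) * ε) 0) ^ (k + 1) := by
  have hm : Measurable fun ω => chainCount ε (k + 1) (interarrival fun j => X j ω) (L - ε) :=
    (measurable_chainCount ε (k + 1)).comp
      ((measurable_pi_lambda _ hX.measurable_interarrival).prodMk measurable_const)
  have hint := hX.lintegral_chainCount_interarrival hlam hε k (L - ε)
  have hne : ∫⁻ ω, chainCount ε (k + 1) (interarrival fun j => X j ω) (L - ε) ∂μ ≠ ⊤ := by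
    rw [hint]; exact ENNReal.ofReal_ne_top
  have hae : (fun ω => ((k + 1).factorial : ℝ) *
      (chainCount ε (k + 1) (interarrival fun j => X j ω) (L - ε)).toReal) =ᵐ[μ]
      fun ω => ((numCompleteClusters ε L (fun j => X j ω)).descFactorial (k + 1) : ℝ) := by
    filter_upwards [hX.ae_chainCount_eq hlam hε L] with ω hω
    rw [hω.2, ENNReal.toReal_natCast, Nat.descFactorial_eq_factorial_mul_choose, Nat.cast_mul]
  refine ⟨((integrable_toReal_of_lintegral_ne_top hm.aemeasurable hne).const_mul _).congr hae, ?_⟩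
  rw [← integral_congr_ae hae, integral_const_mul,
    integral_toReal hm.aemeasurable (ae_lt_top hm hne), hint,
    ENNReal.toReal_ofReal (by positivity), mul_pow _ (max _ _)]
  have : L - ε - k * ε = L - (k + 1) * ε := by ring
  rw [this]
  field_simp

end IsPoissonProcess

theorem mainTheorem2 {Ω : Type*} [MeasurableSpace Ω] (μ : Measure Ω) [IsProbabilityMeasure μ]
    (lam ε L : ℝ) (hlam : 0 < lam) (hε : 0 < ε) (hL : 0 < L)
    (X : ℕ → Ω → ℝ) (hX : IsPoissonProcess μ lam X) (m : ℕ) (hm : 1 ≤ m) :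
    (∀ᵐ ω ∂μ, (completeClusters ε L (fun j => X j ω)).Finite) ∧
    Integrable (fun ω => (numCompleteClusters ε L (fun j => X j ω) : ℝ) ^ m) μ ∧
    ∫ ω, (numCompleteClusters ε L (fun j => X j ω) : ℝ) ^ m ∂μ =
      ∑ k ∈ Finset.Icc 1 m, (Nat.stirlingSecond m k : ℝ) *
        ((L / ε - (k : ℝ)) * (lam * ε * Real.exp (-(lam * ε)))) ^ k *
        (if (k : ℝ) < L / ε then (1 : ℝ) else 0) := by
  have hsum : (fun ω => (numCompleteClusters ε L (fun j => X j ω) : ℝ) ^ m) = fun ω =>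
      ∑ k ∈ Finset.range m, (Nat.stirlingSecond m (k + 1) : ℝ) *
        ((numCompleteClusters ε L (fun j => X j ω)).descFactorial (k + 1) : ℝ) := by
    funext ω
    -- Since `m` is positive, the Stirling number with index `0` vanishes and the sum starts at `1`.
    obtain ⟨m, rfl⟩ := Nat.exists_eq_add_of_le' hm
    have h := Nat.pow_eq_sum_stirlingSecond_mul_descFactorial
      (numCompleteClusters ε L (fun j => X j ω)) (m + 1)
    rw [Finset.sum_range_succ', Nat.stirlingSecond_succ_zero, zero_mul, add_zero] at h
    exact_mod_cast h
  have hint (k : ℕ) := (hX.integral_descFactorial_numCompleteClusters hlam hε L k).1.const_mul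
    (Nat.stirlingSecond m (k + 1) : ℝ)
  refine ⟨(hX.ae_chainCount_eq hlam hε L).mono fun ω h => h.1, ?_, ?_⟩
  · rw [hsum]
    exact integrable_finsetSum _ fun k _ => hint k
  · rw [hsum, integral_finsetSum _ fun k _ => hint k, ← Finset.Ico_add_one_right_eq_Icc,
      Finset.sum_Ico_eq_sum_range, Nat.add_sub_cancel]
    refine Finset.sum_congr rfl fun k _ => ?_
    rw [integral_const_mul, (hX.integral_descFactorial_numCompleteClusters hlam hε L k).2,
      add_comm 1 k, mul_assoc (Nat.stirlingSecond m (k + 1) : ℝ)]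
    congr 1
    push_cast
    -- The indicator plays the role of the positive part, because the exponent `k + 1` is nonzero.
    by_cases hk : (k : ℝ) + 1 < L / ε
    · rw [if_pos hk, mul_one, max_eq_left (by linarith [(lt_div_iff₀ hε).1 hk])]
      congr 1
      field_simp
    · rw [if_neg hk, mul_zero, max_eq_right (by linarith [(div_le_iff₀ hε).1 (not_lt.1 hk)])]
      simp
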